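/- Let $n\ge 2$ be an integer and $w$ a real number. Let $A(w)$ be the $n\times n$ adjacency matrix of the unweighted path on vertices $1,\dots,n$ with a loop of weight $w$ added at each of the end vertices $1$ and $n$; that is, $A(w)_{j,j+1}=A(w)_{j+1,j}=1$ for $1\le j\le n-1$, $A(w)_{1,1}=A(w)_{n,n}=w$, and all other entries are $0$. Let $\lambda_1\ge\lambda_2\ge\dots\ge\lambda_n$ be the eigenvalues of $A(w)$, counted with multiplicity. For real $t$ put $U(t)=\exp(i\,t\,A(w))$, and let $p(t)=|U(t)_{1,n}|^2$ be the fidelity of state transfer from vertex $1$ to vertex $n$ at time $t$. Suppose that $w$ yields pretty good state transfer from one end vertex to the other, i.e. for every $\epsilon>0$ there is a real time $t_\epsilon$ with $|U(t_\epsilon)_{1,n}|>1-\epsilon$. Let $(t_j)_{j\in\mathbb N}$ be a sequence of readout times, $t_j\ge 0$, such that $p(t_j)\to 1$ as $j\to\infty$. Then $\lambda_1>\lambda_2$, and there are sequences $k_j\in\mathbb N=\{0,1,2,\dots\}$ and $z_j\in[-\pi,\pi]$ such that $$t_j=\frac{(2k_j+1)\pi+z_j}{\lambda_1-\lambda_2}\quad\text{for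 all } j\in\mathbb N,\qquad\text{and}\qquad z_j\to 0 \text{ as } j\to\infty .$$ -/

import Mathlib

noncomputable section

namespace LoopedPath

/-- The path on `n` vertices with the ends labelled `0` and `n - 1`, each end vertex carrying a loop
of weight `w`: its (weighted) adjacency matrix `A(w)`. -/
def adj (n : ℕ) (w : ℝ) : Matrix (Fin n) (Fin n) ℝ :=
  Matrix.of fun i j =>
    (if i.val + 1 = j.val ∨ j.val + 1 = i.val then 1 else 0) +
      (if i = j ∧ (i.val = 0 ∨ i.val + 1 = n) then w else 0)

theorem adj_isHermitian (n : ℕ) (w : ℝ) : (adj n w).IsHermitian := by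
  ext i j
  simp only [adj, Matrix.conjTranspose_apply, Matrix.of_apply, star_trivial]
  by_cases h : i = j
  · subst h; rfl
  · simp [h, Ne.symm h, or_comm]

/-- The eigenvalues of `A(w)`, with multiplicity, in nonincreasing order;
the index starts at `0`, so `eig n w 0` is the largest one. -/
def eig (n : ℕ) (w : ℝ) (k : Fin n) : ℝ :=
  (adj_isHermitian n w).eigenvalues₀ (Fin.cast (Fintype.card_fin n).symm k)

/-- The evolution operator `U(t) = exp (i t A(w))`. -/
def evolution (n : ℕ) (w t : ℝ) : Matrix (Fin n) (Fin n) ℂ :=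
  NormedSpace.exp ((Complex.I * (t : ℂ)) • (adj n w).map Complex.ofReal)

/-- The fidelity `p(t) = |U(t)_{a,b}|²` of state transfer from `a` to `b` at readout time `t`. -/
def fidelity (n : ℕ) (w : ℝ) (a b : Fin n) (t : ℝ) : ℝ :=
  ‖evolution n w t a b‖ ^ 2

/-- Pretty good state transfer from vertex `a` to vertex `b`. -/
def PrettyGoodStateTransfer (n : ℕ) (w : ℝ) (a b : Fin n) : Prop :=
  ∀ ε : ℝ, 0 < ε → ∃ t : ℝ, 1 - ε < ‖evolution n w t a b‖

/-- The first end vertex of a path on at least two vertices. -/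
def first (n : ℕ) (hn : 2 ≤ n) : Fin n := ⟨0, by omega⟩

/-- The last end vertex of a path on at least two vertices. -/
def last (n : ℕ) (hn : 2 ≤ n) : Fin n := ⟨n - 1, by omega⟩

/-- The largest eigenvalue `λ₁` of `A(w)`. -/
def lam1 (n : ℕ) (hn : 2 ≤ n) (w : ℝ) : ℝ := eig n w ⟨0, by omega⟩

/-- The second largest eigenvalue `λ₂` of `A(w)`, counted with multiplicity. -/
def lam2 (n : ℕ) (hn : 2 ≤ n) (w : ℝ) : ℝ := eig n w ⟨1, by omega⟩

end LoopedPath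

end

namespace LoopedPath

open Matrix Finset Filter

/-! In an orthonormal eigenbasis `V`, the amplitude from end to end is a sum of phases `exp (i t
λ_k)` with real coefficients `V k first * V k last`, whose absolute values sum to at most 1. An
amplitude of modulus near 1 therefore forces every pair of phases to be nearly aligned after
correction by the signs of the coefficients. For the two largest eigenvalues the signs are opposite:
the spectrum is simple, the top eigenvector is symmetric under reflection (`row_zero_rev`) and the
second is antisymmetric (`row_one_rev`, by a nodal domain argument). So `t (λ₁ - λ₂)` must be close
to an odd multiple of `π`; `one_add_cos_gap_le` makes this quantitative. -/

/-! ### Tridiagonal structure and reflection symmetry. -/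

theorem adj_nonneg_of_ne {n : ℕ} {w : ℝ} {i j : Fin n} (h : i ≠ j) : 0 ≤ adj n w i j := by
  simp only [adj, Matrix.of_apply, h, false_and, if_false, add_zero]
  split_ifs <;> norm_num

theorem adj_eq_zero_of_lt {n : ℕ} {w : ℝ} {i j : Fin n} (h : i.val + 1 < j.val) :
    adj n w i j = 0 := by
  have h1 : i ≠ j := by rintro rfl; omega
  simp only [adj, Matrix.of_apply, h1, false_and, if_false, add_zero]
  rw [if_neg (by omega)]

theorem adj_rev (n : ℕ) (w : ℝ) (i j : Fin n) : adj n w i.rev j.rev = adj n w i j := by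
  have hi := i.isLt
  have hj := j.isLt
  simp only [adj, Matrix.of_apply, Fin.rev_inj, Fin.val_rev]
  congr 1
  · congr 1
    apply propext
    omega
  · congr 1
    apply propext
    omega

theorem mulVec_comp_rev (n : ℕ) (w : ℝ) (y : Fin n → ℝ) (i : Fin n) :
    (adj n w *ᵥ fun j => y j.rev) i = (adj n w *ᵥ y) i.rev := by
  simp only [Matrix.mulVec, dotProduct]
  rw [← Equiv.sum_comp Fin.revPerm]
  refine Finset.sum_congr rfl fun j _ => ?_
  rw [Fin.revPerm_apply, Fin.rev_rev, ← adj_rev, Fin.rev_rev]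

/-- Reflecting an eigenvector gives an eigenvector. -/
theorem mulVec_comp_rev_of_eigen {n : ℕ} {w μ : ℝ} {y : Fin n → ℝ}
    (h : adj n w *ᵥ y = μ • y) :
    (adj n w *ᵥ fun j => y j.rev) = μ • fun j => y j.rev := by
  ext i
  rw [mulVec_comp_rev, h]
  rfl

/-- An eigenvector that vanishes at the first vertex is zero. -/
theorem eq_zero_of_first_eq_zero {n : ℕ} (hn : 2 ≤ n) {w μ : ℝ} {y : Fin n → ℝ}
    (h : adj n w *ᵥ y = μ • y) (h0 : y (first n hn) = 0) : y = 0 := by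
  suffices H : ∀ m : ℕ, ∀ hm : m < n, y ⟨m, hm⟩ = 0 by
    ext i
    exact H i.val i.isLt
  intro m
  induction m using Nat.strong_induction_on with
  | _ m ih =>
    intro hm
    rcases m with _ | m
    · exact h0
    -- In row `m` all entries of `y` up to index `m` vanish by induction, and `y (m + 1)` has
    -- coefficient 1.
    have hrow := congrFun h ⟨m, by omega⟩
    rw [Pi.smul_apply, ih m (by omega) (by omega), smul_zero, Matrix.mulVec, dotProduct,
      Finset.sum_eq_single ⟨m + 1, hm⟩] at hrow
    · simpa [adj] using hrow
    · intro j _ hj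
      rcases lt_or_ge j.val (m + 1) with hlt | hge
      · rw [ih j.val hlt j.isLt, mul_zero]
      · have : j.val ≠ m + 1 := fun e => hj (Fin.ext e)
        rw [(adj_eq_zero_of_lt (w := w) (i := ⟨m, by omega⟩) (j := j)
          (show m + 1 < j.val by omega)), zero_mul]
    · exact fun hh => absurd (Finset.mem_univ _) hh

/-- Eigenvectors with the same eigenvalue are proportional. -/
theorem eigen_proportional {n : ℕ} (hn : 2 ≤ n) {w μ : ℝ} {x y : Fin n → ℝ}
    (hx : adj n w *ᵥ x = μ • x) (hy : adj n w *ᵥ y = μ • y) (i : Fin n) :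
    x (first n hn) * y i = y (first n hn) * x i := by
  have key : x (first n hn) • y - y (first n hn) • x = 0 := by
    apply eq_zero_of_first_eq_zero hn (w := w) (μ := μ)
    · rw [Matrix.mulVec_sub, Matrix.mulVec_smul, Matrix.mulVec_smul, hx, hy, smul_sub,
        smul_comm μ, smul_comm μ]
    · simp only [Pi.sub_apply, Pi.smul_apply, smul_eq_mul]
      ring
  have := congrFun key i
  simp only [Pi.sub_apply, Pi.smul_apply, smul_eq_mul, Pi.zero_apply] at this
  linarith

/-! ### Orthonormal eigenbasis and Rayleigh quotients. -/

theorem eig_antitone (n : ℕ) (w : ℝ) : Antitone (eig n w) := fun _ _ hij =>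
  (adj_isHermitian n w).eigenvalues₀_antitone hij

/-- `V` is an orthogonal matrix whose rows are eigenvectors of `A(w)`, in the order of `eig`. -/
structure IsEigenbasis (n : ℕ) (w : ℝ) (V : Matrix (Fin n) (Fin n) ℝ) : Prop where
  mulVec_row : ∀ k, adj n w *ᵥ V k = eig n w k • V k
  mul_transpose : V * Vᵀ = 1

theorem exists_isEigenbasis (n : ℕ) (w : ℝ) : ∃ V, IsEigenbasis n w V := by
  set hA := adj_isHermitian n w
  let e : Fin n ≃ Fin n := (finCongr (Fintype.card_fin n).symm).trans
    (Fintype.equivOfCardEq (Fintype.card_fin _))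
  have he : ∀ k, hA.eigenvalues (e k) = eig n w k := by
    intro k
    simp [Matrix.IsHermitian.eigenvalues, eig, e]
  refine ⟨Matrix.of fun k => ⇑(hA.eigenvectorBasis (e k)), ⟨fun k => ?_, ?_⟩⟩
  · change adj n w *ᵥ ⇑(hA.eigenvectorBasis (e k)) = _ • ⇑(hA.eigenvectorBasis (e k))
    rw [hA.mulVec_eigenvectorBasis, he]
  · ext i j
    have := orthonormal_iff_ite.mp hA.eigenvectorBasis.orthonormal (e i) (e j)
    simp only [EmbeddingLike.apply_eq_iff_eq] at this
    rw [Matrix.one_apply, ← this, Matrix.mul_apply]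
    simp [PiLp.inner_apply, mul_comm]

namespace IsEigenbasis

variable {n : ℕ} {w : ℝ} {V : Matrix (Fin n) (Fin n) ℝ}

theorem transpose_mul (hV : IsEigenbasis n w V) : Vᵀ * V = 1 :=
  mul_eq_one_comm.mp hV.mul_transpose

theorem row_dotProduct (hV : IsEigenbasis n w V) (k l : Fin n) :
    V k ⬝ᵥ V l = if k = l then 1 else 0 := by
  have := congrFun (congrFun hV.mul_transpose k) l
  rwa [Matrix.one_apply] at this

theorem col_dotProduct (hV : IsEigenbasis n w V) (i j : Fin n) :
    ∑ k, V k i * V k j = if i = j then 1 else 0 := by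
  have := congrFun (congrFun hV.transpose_mul i) j
  rwa [Matrix.one_apply, Matrix.mul_apply] at this

theorem row_ne_zero (hV : IsEigenbasis n w V) (k : Fin n) : V k ≠ 0 := by
  intro h
  have := hV.row_dotProduct k k
  rw [if_pos rfl, h, zero_dotProduct] at this
  exact zero_ne_one this

theorem row_first_ne_zero (hV : IsEigenbasis n w V) (hn : 2 ≤ n) (k : Fin n) :
    V k (first n hn) ≠ 0 := fun h =>
  hV.row_ne_zero k (eq_zero_of_first_eq_zero hn (hV.mulVec_row k) h)

theorem mulVec_mulVec_adj (hV : IsEigenbasis n w V) (y : Fin n → ℝ) (k : Fin n) :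
    (V *ᵥ (adj n w *ᵥ y)) k = eig n w k * (V *ᵥ y) k := by
  have hs : (adj n w)ᵀ = adj n w := by
    simpa [Matrix.IsHermitian] using adj_isHermitian n w
  change V k ⬝ᵥ (adj n w *ᵥ y) = eig n w k * (V k ⬝ᵥ y)
  rw [Matrix.dotProduct_mulVec, ← Matrix.mulVec_transpose, hs, hV.mulVec_row, smul_dotProduct,
    smul_eq_mul]

theorem dotProduct_mulVec (hV : IsEigenbasis n w V) (x y : Fin n → ℝ) :
    (V *ᵥ x) ⬝ᵥ (V *ᵥ y) = x ⬝ᵥ y := by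
  rw [Matrix.dotProduct_mulVec, ← Matrix.mulVec_transpose, Matrix.mulVec_mulVec,
    hV.transpose_mul, Matrix.one_mulVec]

/-- A maximizer of the Rayleigh quotient, over vectors that only see eigenvalues `≤ μ`,
is an eigenvector. -/
theorem eigen_of_le_rayleigh (hV : IsEigenbasis n w V) {μ : ℝ} {y : Fin n → ℝ}
    (hk : ∀ k, eig n w k ≤ μ ∨ V k ⬝ᵥ y = 0)
    (hy : μ * (y ⬝ᵥ y) ≤ y ⬝ᵥ (adj n w *ᵥ y)) : adj n w *ᵥ y = μ • y := by
  -- In eigenbasis coordinates the Rayleigh deficit is a sum of nonnegative terms, so each of them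
  -- vanishes.
  have h1 : ∑ k, (μ - eig n w k) * (V *ᵥ y) k ^ 2 ≤ 0 := by
    have e1 := hV.dotProduct_mulVec y (adj n w *ᵥ y)
    have e2 := hV.dotProduct_mulVec y y
    rw [← e1, ← e2] at hy
    have : ∑ k, (μ - eig n w k) * (V *ᵥ y) k ^ 2 =
        μ * ((V *ᵥ y) ⬝ᵥ (V *ᵥ y)) - (V *ᵥ y) ⬝ᵥ (V *ᵥ (adj n w *ᵥ y)) := by
      simp only [dotProduct, Finset.mul_sum]
      rw [← Finset.sum_sub_distrib]
      refine Finset.sum_congr rfl fun k _ => ?_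
      rw [hV.mulVec_mulVec_adj]
      ring
    linarith
  have h2 : ∀ k ∈ Finset.univ, 0 ≤ (μ - eig n w k) * (V *ᵥ y) k ^ 2 := by
    intro k _
    rcases hk k with h | h
    · exact mul_nonneg (sub_nonneg.mpr h) (sq_nonneg _)
    · have : (V *ᵥ y) k = 0 := h
      simp [this]
  have h3 := (Finset.sum_eq_zero_iff_of_nonneg h2).mp (le_antisymm h1 (Finset.sum_nonneg h2))
  have h4 : V *ᵥ (adj n w *ᵥ y) = V *ᵥ (μ • y) := by
    ext k
    rw [hV.mulVec_mulVec_adj, Matrix.mulVec_smul, Pi.smul_apply, smul_eq_mul]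
    rcases mul_eq_zero.mp (h3 k (Finset.mem_univ k)) with h | h
    · rw [sub_eq_zero.mp h]
    · rw [pow_eq_zero_iff two_ne_zero] at h
      rw [h, mul_zero, mul_zero]
  have h5 := congrArg (fun x => Vᵀ *ᵥ x) h4
  simpa [Matrix.mulVec_mulVec, ← Matrix.mul_assoc, hV.transpose_mul] using h5

/-- A repeated eigenvalue would make two orthogonal rows proportional. -/
theorem eig_strictAnti (hV : IsEigenbasis n w V) (hn : 2 ≤ n) : StrictAnti (eig n w) := by
  refine (eig_antitone n w).strictAnti_of_injective fun k l hkl => ?_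
  by_contra hne
  have hl : adj n w *ᵥ V l = eig n w k • V l := by rw [hkl]; exact hV.mulVec_row l
  have hp := eigen_proportional hn (hV.mulVec_row k) hl
  have hz : V k (first n hn) * (V l ⬝ᵥ V l) = V l (first n hn) * (V l ⬝ᵥ V k) := by
    simp only [dotProduct, Finset.mul_sum]
    refine Finset.sum_congr rfl fun i _ => ?_
    linear_combination V l i * hp i
  rw [hV.row_dotProduct, hV.row_dotProduct, if_pos rfl, if_neg (Ne.symm hne), mul_one,
    mul_zero] at hz
  exact hV.row_first_ne_zero hn k hz

/-! ### Parity of the first two eigenvectors. -/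

/-- Every eigenvector is symmetric or antisymmetric. -/
theorem row_rev (hV : IsEigenbasis n w V) (hn : 2 ≤ n) (k : Fin n) :
    (∀ i, V k i.rev = V k i) ∨ (∀ i, V k i.rev = -V k i) := by
  have hp := eigen_proportional hn (hV.mulVec_row k) (mulVec_comp_rev_of_eigen (hV.mulVec_row k))
  set a := V k (first n hn)
  set b := V k (first n hn).rev
  have ha : a ≠ 0 := hV.row_first_ne_zero hn k
  have hb : a * a = b * b := by simpa using hp (first n hn).rev
  rcases mul_self_eq_mul_self_iff.mp hb with h | h
  · left
    intro i
    have := hp i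
    rw [← h] at this
    exact mul_left_cancel₀ ha this
  · right
    intro i
    have := hp i
    apply mul_left_cancel₀ ha
    rw [this, h]
    ring

/-- The entrywise absolute value of the top eigenvector is again a top eigenvector. -/
theorem abs_top_eigen (hV : IsEigenbasis n w V) (hn : 2 ≤ n) :
    (adj n w *ᵥ fun i => |V ⟨0, by omega⟩ i|) =
      eig n w ⟨0, by omega⟩ • fun i => |V ⟨0, by omega⟩ i| := by
  apply hV.eigen_of_le_rayleigh
  · intro k
    left
    exact eig_antitone n w (Fin.mk_le_of_le_val (Nat.zero_le _))
  · set v := V ⟨0, by omega⟩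
    have h1 : (fun i => |v i|) ⬝ᵥ (fun i => |v i|) = v ⬝ᵥ v := by
      simp [dotProduct, abs_mul_abs_self]
    have h2 : v ⬝ᵥ (adj n w *ᵥ v) = eig n w ⟨0, by omega⟩ * (v ⬝ᵥ v) := by
      rw [hV.mulVec_row, dotProduct_smul, smul_eq_mul]
    rw [h1, ← h2]
    simp only [dotProduct, Matrix.mulVec, Finset.mul_sum]
    refine Finset.sum_le_sum fun i _ => Finset.sum_le_sum fun j _ => ?_
    -- The loop weight may be negative, but diagonal terms are unchanged by absolute values.
    by_cases hij : i = j
    · subst hij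
      exact le_of_eq (by linear_combination -adj n w i i * abs_mul_abs_self (v i))
    · have h3 : v i * v j ≤ |v i| * |v j| := by
        rw [← abs_mul]
        exact le_abs_self _
      have := mul_le_mul_of_nonneg_left h3 (adj_nonneg_of_ne (w := w) hij)
      linarith

theorem top_proportional (hV : IsEigenbasis n w V) (hn : 2 ≤ n) (i : Fin n) :
    |V ⟨0, by omega⟩ (first n hn)| * V ⟨0, by omega⟩ i =
      V ⟨0, by omega⟩ (first n hn) * |V ⟨0, by omega⟩ i| :=
  eigen_proportional hn (hV.abs_top_eigen hn) (hV.mulVec_row _) i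

/-- The top eigenvector is symmetric. -/
theorem row_zero_rev (hV : IsEigenbasis n w V) (hn : 2 ≤ n) (i : Fin n) :
    V ⟨0, by omega⟩ i.rev = V ⟨0, by omega⟩ i := by
  have hp := hV.top_proportional hn
  have ha : |V ⟨0, by omega⟩ (first n hn)| ≠ 0 := abs_ne_zero.mpr (hV.row_first_ne_zero hn _)
  have habs : |V ⟨0, by omega⟩ i.rev| = |V ⟨0, by omega⟩ i| := by
    rcases hV.row_rev hn ⟨0, by omega⟩ with h | h
    · rw [h]
    · rw [h, abs_neg]
  apply mul_left_cancel₀ ha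
  rw [hp, hp, habs]

/-- An eigenvector of the second largest eigenvalue is not symmetric: otherwise its restriction to
the first and last nodal domains, with one sign flipped, has at least the same Rayleigh quotient,
is antisymmetric and hence would be an eigenvector of the same eigenvalue. -/
theorem not_symmetric_second (hV : IsEigenbasis n w V) (hn : 2 ≤ n) {u : Fin n → ℝ}
    (hu : adj n w *ᵥ u = eig n w ⟨1, by omega⟩ • u) (hpos : 0 < u (first n hn))
    (horth : V ⟨0, by omega⟩ ⬝ᵥ u = 0) : ¬ ∀ i, u i.rev = u i := by
  intro hsym
  have ha := hV.row_first_ne_zero hn ⟨0, by omega⟩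
  -- The top eigenvector has constant sign, so a vector orthogonal to it cannot be positive
  -- everywhere.
  have hneg : ∃ m : ℕ, ∃ h : m < n, u ⟨m, h⟩ ≤ 0 := by
    by_contra! hcon
    have hall : ∀ i, 0 < u i := fun i => hcon i.val i.isLt
    have hsum : ∑ i, |V ⟨0, by omega⟩ i| * u i = 0 := by
      apply mul_left_cancel₀ ha
      rw [mul_zero, Finset.mul_sum]
      have : |V ⟨0, by omega⟩ (first n hn)| * (V ⟨0, by omega⟩ ⬝ᵥ u) = 0 := by
        rw [horth, mul_zero]
      rw [← this, dotProduct, Finset.mul_sum]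
      refine Finset.sum_congr rfl fun i _ => ?_
      rw [← mul_assoc, ← hV.top_proportional hn, mul_assoc]
    have h0 := (Finset.sum_eq_zero_iff_of_nonneg
      (fun i _ => mul_nonneg (abs_nonneg _) (hall i).le)).mp hsum (first n hn) (Finset.mem_univ _)
    exact mul_ne_zero (abs_ne_zero.mpr ha) hpos.ne' h0
  classical
  obtain ⟨m, ⟨hm, hum⟩, hmin⟩ : ∃ m : ℕ, (∃ h : m < n, u ⟨m, h⟩ ≤ 0) ∧
      ∀ i : Fin n, i.val < m → 0 < u i :=
    ⟨Nat.find hneg, Nat.find_spec hneg, fun i hi =>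
      not_le.mp fun hle => Nat.find_min hneg hi ⟨i.isLt, hle⟩⟩
  have hm0 : 0 < m := by
    rcases Nat.eq_zero_or_pos m with h | h
    · subst h
      exact absurd hpos (not_lt.mpr hum)
    · exact h
  -- By symmetry the mirror image of `m` is not in the initial positive block either, so that block
  -- and its reflection are separated by at least one vertex.
  have hmn : 2 * m + 1 ≤ n := by
    by_contra hlt
    have := hmin (Fin.rev ⟨m, hm⟩) (by rw [Fin.val_rev]; dsimp only; omega)
    rw [hsym] at this
    linarith
  let y : Fin n → ℝ := fun i => if i.val < m then u i else if n ≤ i.val + m then -u i else 0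
  have hyl : ∀ i : Fin n, i.val < m → y i = u i := fun i hi => if_pos hi
  have hyr : ∀ i : Fin n, n ≤ i.val + m → y i = -u i := fun i hi => by
    simp only [y]
    rw [if_neg (by omega), if_pos hi]
  have hym : ∀ i : Fin n, m ≤ i.val → i.val + m < n → y i = 0 := fun i h1 h2 => by
    simp only [y]
    rw [if_neg (by omega), if_neg (by omega)]
  have hyanti : ∀ i, y i.rev = -y i := by
    intro i
    have hi := i.isLt
    have hr := Fin.val_rev i
    rcases lt_or_ge i.val m with h | h
    · rw [hyl i h, hyr i.rev (by omega), hsym]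
    · rcases lt_or_ge (i.val + m) n with h' | h'
      · rw [hym i h h', hym i.rev (by omega) (by omega), neg_zero]
      · rw [hyr i h', hyl i.rev (by omega), hsym, neg_neg]
  -- Inside the block, passing from `u` to `y` only replaces the nonpositive neighbour at `m` by 0.
  have hrow : ∀ i : Fin n, i.val < m →
      eig n w ⟨1, by omega⟩ * u i ≤ (adj n w *ᵥ y) i := by
    intro i hi
    have := congrFun hu i
    rw [Pi.smul_apply, smul_eq_mul] at this
    rw [← this, Matrix.mulVec, Matrix.mulVec, dotProduct, dotProduct]
    refine Finset.sum_le_sum fun j _ => ?_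
    rcases lt_trichotomy j.val m with h | h | h
    · rw [hyl j h]
    · have hj : j = ⟨m, hm⟩ := Fin.ext h
      have hij : i ≠ j := by rintro rfl; omega
      rw [hym j (by omega) (by omega), mul_zero, hj]
      exact mul_nonpos_of_nonneg_of_nonpos (hj ▸ adj_nonneg_of_ne hij) hum
    · rw [(adj_eq_zero_of_lt (w := w) (i := i) (j := j) (by omega)), zero_mul, zero_mul]
  have hAy : ∀ i, (adj n w *ᵥ y) i.rev = -(adj n w *ᵥ y) i := by
    intro i
    rw [← mulVec_comp_rev]
    have : (fun j : Fin n => y j.rev) = -y := funext hyanti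
    rw [this, Matrix.mulVec_neg, Pi.neg_apply]
  have hray : eig n w ⟨1, by omega⟩ * (y ⬝ᵥ y) ≤ y ⬝ᵥ (adj n w *ᵥ y) := by
    rw [dotProduct, dotProduct, Finset.mul_sum]
    refine Finset.sum_le_sum fun i _ => ?_
    have hleft : ∀ i : Fin n, i.val < m →
        eig n w ⟨1, by omega⟩ * (y i * y i) ≤ y i * (adj n w *ᵥ y) i := by
      intro i hi
      rw [hyl i hi]
      have := mul_le_mul_of_nonneg_left (hrow i hi) (hmin i hi).le
      linarith
    rcases lt_or_ge i.val m with h | h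
    · exact hleft i h
    · rcases lt_or_ge (i.val + m) n with h' | h'
      · simp [hym i h h']
      · have hi := i.isLt
        have := hleft i.rev (by rw [Fin.val_rev]; omega)
        rw [hyanti, hAy] at this
        linarith
  have hyorth : V ⟨0, by omega⟩ ⬝ᵥ y = 0 := by
    have : V ⟨0, by omega⟩ ⬝ᵥ y = -(V ⟨0, by omega⟩ ⬝ᵥ y) := by
      conv_lhs => rw [dotProduct, ← Equiv.sum_comp Fin.revPerm]
      rw [dotProduct, ← Finset.sum_neg_distrib]
      refine Finset.sum_congr rfl fun i _ => ?_
      rw [Fin.revPerm_apply, hyanti, hV.row_zero_rev hn, mul_neg]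
    linarith
  have hyeig : adj n w *ᵥ y = eig n w ⟨1, by omega⟩ • y := by
    refine hV.eigen_of_le_rayleigh (fun k => ?_) hray
    rcases Nat.eq_zero_or_pos k.val with h | h
    · right
      have hk : k = ⟨0, by omega⟩ := Fin.ext h
      rw [hk]
      exact hyorth
    · left
      exact eig_antitone n w (Fin.mk_le_of_le_val h)
  -- A symmetric and an antisymmetric vector, equal and nonzero at the first vertex, cannot be
  -- proportional.
  have hp := eigen_proportional hn hu hyeig (first n hn).rev
  rw [hyanti, hsym, hyl (first n hn) hm0] at hp
  nlinarith [mul_pos hpos hpos]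

/-- The eigenvector of the second largest eigenvalue is antisymmetric. -/
theorem row_one_rev (hV : IsEigenbasis n w V) (hn : 2 ≤ n) (i : Fin n) :
    V ⟨1, by omega⟩ i.rev = -V ⟨1, by omega⟩ i := by
  rcases hV.row_rev hn ⟨1, by omega⟩ with h | h
  · exfalso
    have horth : V ⟨0, by omega⟩ ⬝ᵥ V ⟨1, by omega⟩ = 0 := by
      rw [hV.row_dotProduct, if_neg (by simp)]
    rcases lt_or_gt_of_ne (hV.row_first_ne_zero hn ⟨1, by omega⟩) with hneg | hpos
    · refine hV.not_symmetric_second hn (u := -V ⟨1, by omega⟩) ?_ (neg_pos.mpr hneg) ?_ ?_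
      · rw [Matrix.mulVec_neg, hV.mulVec_row, smul_neg]
      · rw [dotProduct_neg, horth, neg_zero]
      · intro j
        rw [Pi.neg_apply, Pi.neg_apply, h]
    · exact hV.not_symmetric_second hn (hV.mulVec_row _) hpos horth h
  · exact h i

/-! ### Transfer amplitude as a sum of phases. -/

/-- The spectral decomposition of the entries of the evolution operator. -/
theorem evolution_apply (hV : IsEigenbasis n w V) (t : ℝ) (a b : Fin n) :
    evolution n w t a b =
      ∑ k, ((V k a * V k b : ℝ) : ℂ) * Complex.exp (((t * eig n w k : ℝ) : ℂ) * Complex.I) := by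
  set W : Matrix (Fin n) (Fin n) ℂ := V.map Complex.ofReal
  have hW : Wᵀ * W = 1 := by
    have := congrArg (fun M : Matrix (Fin n) (Fin n) ℝ => M.map Complex.ofRealHom) hV.transpose_mul
    simp only [Matrix.map_mul] at this
    rw [Matrix.map_one _ (map_zero _) (map_one _)] at this
    exact this
  have hinv : (Wᵀ)⁻¹ = W := Matrix.inv_eq_right_inv hW
  have hunit : IsUnit Wᵀ := IsUnit.of_mul_eq_one _ hW
  have hreal : adj n w = Vᵀ * Matrix.diagonal (eig n w) * V := by
    have h1 : V * adj n w = Matrix.diagonal (eig n w) * V := by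
      ext k j
      rw [Matrix.diagonal_mul]
      have h2 := congrFun (hV.mulVec_row k) j
      rw [Pi.smul_apply, smul_eq_mul] at h2
      rw [← h2, Matrix.mul_apply, Matrix.mulVec, dotProduct]
      refine Finset.sum_congr rfl fun i _ => ?_
      have h3 := (adj_isHermitian n w).apply i j
      rw [star_trivial] at h3
      rw [← h3, mul_comm]
    rw [Matrix.mul_assoc, ← h1, ← Matrix.mul_assoc, hV.transpose_mul, Matrix.one_mul]
  have hA : (Complex.I * (t : ℂ)) • (adj n w).map Complex.ofReal =
      Wᵀ * Matrix.diagonal (fun k => ((t * eig n w k : ℝ) : ℂ) * Complex.I) * (Wᵀ)⁻¹ := by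
    rw [hinv]
    conv_lhs => rw [hreal]
    ext i j
    rw [Matrix.smul_apply, Matrix.map_apply, Matrix.mul_apply, Matrix.mul_apply, smul_eq_mul,
      Complex.ofReal_sum, Finset.mul_sum]
    refine Finset.sum_congr rfl fun k _ => ?_
    simp only [W, Matrix.mul_diagonal, Matrix.transpose_apply, Matrix.map_apply,
      Complex.ofReal_mul]
    ring
  rw [evolution, hA, Matrix.exp_conj _ _ hunit, hinv, Matrix.exp_diagonal, Matrix.mul_apply]
  refine Finset.sum_congr rfl fun k _ => ?_
  rw [Matrix.mul_diagonal, Pi.coe_exp, ← Complex.exp_eq_exp_ℂ]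
  simp only [W, Matrix.transpose_apply, Matrix.map_apply, Complex.ofReal_mul]
  ring

theorem sum_abs_le_one (hV : IsEigenbasis n w V) (a b : Fin n) :
    ∑ k, |V k a * V k b| ≤ 1 := by
  have ha := hV.col_dotProduct a a
  have hb := hV.col_dotProduct b b
  rw [if_pos rfl] at ha hb
  have : ∑ k, |V k a * V k b| ≤ ∑ k, (V k a * V k a + V k b * V k b) / 2 := by
    refine Finset.sum_le_sum fun k _ => ?_
    rw [abs_le]
    constructor <;> nlinarith [sq_nonneg (V k a + V k b), sq_nonneg (V k a - V k b)]
  rw [← Finset.sum_div, Finset.sum_add_distrib, ha, hb] at this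
  linarith

end IsEigenbasis

theorem norm_sq_two_phases (a b α β : ℝ) :
    ‖(a : ℂ) * Complex.exp (α * Complex.I) + (b : ℂ) * Complex.exp (β * Complex.I)‖ ^ 2 =
      a ^ 2 + b ^ 2 + 2 * a * b * Real.cos (α - β) := by
  rw [← Complex.normSq_eq_norm_sq, Complex.normSq_apply, Real.cos_sub]
  simp only [Complex.add_re, Complex.add_im, Complex.re_ofReal_mul, Complex.im_ofReal_mul,
    Complex.exp_ofReal_mul_I_re, Complex.exp_ofReal_mul_I_im]
  linear_combination a ^ 2 * Real.sin_sq_add_cos_sq α + b ^ 2 * Real.sin_sq_add_cos_sq β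

/-- If a combination of phases is almost as long as possible, then two phases whose coefficients
have opposite signs are almost opposite. -/
theorem one_add_cos_le {ι : Type*} [Fintype ι] [DecidableEq ι] (c : ι → ℝ) (θ : ι → ℝ)
    (hc : ∑ k, |c k| ≤ 1) {p q : ι} (hpq : p ≠ q) (hp : 0 < c p) (hq : c q < 0) :
    1 + Real.cos (θ p - θ q) ≤ (c p - c q) / (c p * -c q) *
      (1 - ‖∑ k, (c k : ℂ) * Complex.exp ((θ k : ℂ) * Complex.I)‖) := by
  set f : ι → ℂ := fun k => (c k : ℂ) * Complex.exp ((θ k : ℂ) * Complex.I)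
  have hf : ∀ k, ‖f k‖ = |c k| := by
    intro k
    simp [f, Complex.norm_exp_ofReal_mul_I]
  have hsplit : ∀ {M : Type} [AddCommMonoid M] (g : ι → M),
      ∑ k, g k = (g p + g q) + ∑ k ∈ {p, q}ᶜ, g k := by
    intro M _ g
    rw [← Finset.sum_pair hpq, Finset.sum_add_sum_compl]
  have hrest : ‖∑ k ∈ {p, q}ᶜ, f k‖ ≤ ∑ k ∈ {p, q}ᶜ, |c k| :=
    (norm_sum_le _ _).trans (le_of_eq (Finset.sum_congr rfl fun k _ => hf k))
  have htri := norm_add_le (f p + f q) (∑ k ∈ {p, q}ᶜ, f k)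
  rw [← hsplit f] at htri
  rw [hsplit (fun k => |c k|), abs_of_pos hp, abs_of_neg hq] at hc
  have hs : ‖f p + f q‖ ≤ c p - c q := by
    refine (norm_add_le _ _).trans (le_of_eq ?_)
    rw [hf, hf, abs_of_pos hp, abs_of_neg hq]
    ring
  have hsq := norm_sq_two_phases (c p) (c q) (θ p) (θ q)
  change ‖f p + f q‖ ^ 2 = _ at hsq
  have hs0 := norm_nonneg (f p + f q)
  set s := ‖f p + f q‖
  set N := ‖∑ k, f k‖
  -- The triangle inequality deficit of the pair is at most the total deficit.
  have hd : c p - c q - s ≤ 1 - N := by linarith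
  have hd0 : 0 ≤ c p - c q - s := by linarith
  have hprod : 0 < c p * -c q := mul_pos hp (neg_pos.mpr hq)
  rw [div_mul_eq_mul_div, le_div_iff₀ hprod]
  -- With `S = c p - c q`, `2 * c p * -c q * (1 + cos) = S ^ 2 - s ^ 2 ≤ 2 * S * (S - s)`.
  nlinarith [mul_le_mul_of_nonneg_left hd (show 0 ≤ c p - c q by linarith),
    mul_nonneg hd0 hd0]

theorem one_add_cos_gap_le (n : ℕ) (hn : 2 ≤ n) (w : ℝ) :
    lam2 n hn w < lam1 n hn w ∧ ∃ C : ℝ, ∀ t : ℝ,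
      1 + Real.cos (t * (lam1 n hn w - lam2 n hn w)) ≤
        C * (1 - ‖evolution n w t (first n hn) (last n hn)‖) := by
  obtain ⟨V, hV⟩ := exists_isEigenbasis n w
  refine ⟨hV.eig_strictAnti hn (by simp [Fin.lt_def]), ?_⟩
  set p : Fin n := ⟨0, by omega⟩
  set q : Fin n := ⟨1, by omega⟩
  have hlast : last n hn = (first n hn).rev := by
    ext
    simp [last, first, Fin.val_rev]
  have hp : 0 < V p (first n hn) * V p (last n hn) := by
    rw [hlast, hV.row_zero_rev hn]
    exact mul_self_pos.mpr (hV.row_first_ne_zero hn _)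
  have hq : V q (first n hn) * V q (last n hn) < 0 := by
    rw [hlast, hV.row_one_rev hn, mul_neg]
    exact neg_neg_of_pos (mul_self_pos.mpr (hV.row_first_ne_zero hn _))
  refine ⟨(V p (first n hn) * V p (last n hn) - V q (first n hn) * V q (last n hn)) /
    (V p (first n hn) * V p (last n hn) * -(V q (first n hn) * V q (last n hn))), fun t => ?_⟩
  have := one_add_cos_le (fun k => V k (first n hn) * V k (last n hn)) (fun k => t * eig n w k)
    (hV.sum_abs_le_one _ _) (p := p) (q := q) (by simp [p, q]) hp hq
  rw [← hV.evolution_apply, ← mul_sub] at this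
  exact this

/-! ### Readout times modulo `2π`. -/

theorem exists_odd_mul_pi_add {x : ℝ} (hx : 0 ≤ x) :
    ∃ (k : ℕ) (z : ℝ), z ∈ Set.Icc (-Real.pi) Real.pi ∧ x = (2 * (k : ℝ) + 1) * Real.pi + z := by
  have h2 : 0 < 2 * Real.pi := Real.two_pi_pos
  refine ⟨⌊x / (2 * Real.pi)⌋₊, x - (2 * (⌊x / (2 * Real.pi)⌋₊ : ℝ) + 1) * Real.pi, ?_, by ring⟩
  have hlo := (le_div_iff₀ h2).mp (Nat.floor_le (div_nonneg hx h2.le))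
  have hhi := (div_lt_iff₀ h2).mp (Nat.lt_floor_add_one (x / (2 * Real.pi)))
  constructor <;> linarith

theorem cos_odd_mul_pi_add (k : ℕ) (z : ℝ) :
    Real.cos ((2 * (k : ℝ) + 1) * Real.pi + z) = -Real.cos z := by
  rw [show (2 * (k : ℝ) + 1) * Real.pi + z = (z + Real.pi) + k * (2 * Real.pi) by ring,
    Real.cos_add_nat_mul_two_pi, Real.cos_add_pi]

theorem tendsto_zero_of_cos_tendsto_one {z : ℕ → ℝ}
    (hz : ∀ j, z j ∈ Set.Icc (-Real.pi) Real.pi)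
    (h : Tendsto (fun j => Real.cos (z j)) atTop (nhds 1)) : Tendsto z atTop (nhds 0) := by
  rw [tendsto_zero_iff_abs_tendsto_zero]
  -- On `[-π, π]`, `arccos (cos z) = |z|`.
  have := (Real.continuous_arccos.tendsto 1).comp h
  rw [Real.arccos_one] at this
  refine this.congr fun j => ?_
  rw [Function.comp_apply, Function.comp_apply, ← Real.cos_abs,
    Real.arccos_cos (abs_nonneg _) (abs_le.mpr (hz j))]

end LoopedPath

theorem mainTheorem6 (n : ℕ) (hn : 2 ≤ n) (w : ℝ)
    (hw : LoopedPath.PrettyGoodStateTransfer n w (LoopedPath.first n hn) (LoopedPath.last n hn))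
    (t : ℕ → ℝ) (ht : ∀ j, 0 ≤ t j)
    (hp : Filter.Tendsto
      (fun j => LoopedPath.fidelity n w (LoopedPath.first n hn) (LoopedPath.last n hn) (t j))
      Filter.atTop (nhds 1)) :
    LoopedPath.lam2 n hn w < LoopedPath.lam1 n hn w ∧
      ∃ (k : ℕ → ℕ) (z : ℕ → ℝ),
        (∀ j, z j ∈ Set.Icc (-Real.pi) Real.pi) ∧
        (∀ j, t j = ((2 * (k j : ℝ) + 1) * Real.pi + z j) /
          (LoopedPath.lam1 n hn w - LoopedPath.lam2 n hn w)) ∧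
        Filter.Tendsto z Filter.atTop (nhds 0) := by

  obtain ⟨hlt, C, hC⟩ := LoopedPath.one_add_cos_gap_le n hn w
  refine ⟨hlt, ?_⟩
  have hgap : 0 < LoopedPath.lam1 n hn w - LoopedPath.lam2 n hn w := sub_pos.mpr hlt
  choose k z hz hx using fun j =>
    LoopedPath.exists_odd_mul_pi_add (mul_nonneg (ht j) hgap.le)
  refine ⟨k, z, hz, fun j => ?_, LoopedPath.tendsto_zero_of_cos_tendsto_one hz ?_⟩
  · rw [← hx, mul_div_cancel_right₀ _ hgap.ne']
  have hnorm : Filter.Tendsto (fun j => ‖LoopedPath.evolution n w (t j) (LoopedPath.first n hn)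
      (LoopedPath.last n hn)‖) Filter.atTop (nhds 1) := by
    have := hp.sqrt
    rw [Real.sqrt_one] at this
    exact this.congr fun j => Real.sqrt_sq (norm_nonneg _)
  have hlow : Filter.Tendsto (fun j => 1 - C * (1 - ‖LoopedPath.evolution n w (t j)
      (LoopedPath.first n hn) (LoopedPath.last n hn)‖)) Filter.atTop (nhds 1) := by
    simpa using ((hnorm.const_sub 1).const_mul C).const_sub 1
  refine tendsto_of_tendsto_of_tendsto_of_le_of_le hlow tendsto_const_nhds (fun j => ?_)
    fun j => Real.cos_le_one _
  have := hC (t j)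
  rw [hx, LoopedPath.cos_odd_mul_pi_add] at this
  change 1 - _ ≤ Real.cos (z j)
  linarith
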